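/- Let $\mathbb K=\mathbb R$ or $\mathbb C$. Consider the broadcast channel with two transmit antennas and two single-antenna users, $$y^{[k]}(s)=h^{[k]}_1(s)\,x_1(s)+h^{[k]}_2(s)\,x_2(s)+z^{[k]}(s),\qquad k=1,2,\quad s=0,1,2,\dots,$$ with i.i.d. Gaussian noise of mean $0$ and $\mathbb E|z|^2=1$ (circularly symmetric if $\mathbb K=\mathbb C$), independent of the channel, and average transmit power at most $P$. The channels follow staggered block fading with coherence time $T=2$: with block states $g^{[k]}_b\in\mathbb K^2$, $b=0,1,2,\dots$, one has $h^{[1]}(s)=g^{[1]}_{\lfloor (s+1)/2\rfloor}$ and $h^{[2]}(s)=g^{[2]}_{\lfloor s/2\rfloor}$, so that over each supersymbol $\{2t,2t+1\}$ the channel of user 1 changes and that of user 2 stays fixed. The random sequence $(g^{[1]}_b,g^{[2]}_b)_{b\ge 0}$ is stationary, and for every $t$ the three states $g^{[1]}_t,g^{[1]}_{t+1},g^{[2]}_t$ of a supersymbol have a joint law that is absolutely continuous with respect to Lebesgue measure on $(\mathbb K^2)^3$ (no independence is assumed). The transmitter knows the channel of user 1 perfectly and does not know the realization of the channel of user 2;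 the receivers know all channel states perfectly. Then a total of $3/2$ degrees of freedom is achievable almost surely, by linear beamforming over supersymbols of two symbols. That is, there are real numbers $d_1,d_2\ge 0$ with $d_1+d_2=\tfrac32$, rates $R_k(P)$ with $$\lim_{P\to\infty}\frac{R_k(P)}{\tfrac12\dim_{\mathbb R}(\mathbb K)\,\log P}=d_k ,\qquad k=1,2,$$ and for each $P>0$ and $n$ a code of $2n$ channel uses with power at most $P$ and at least $e^{2nR_k(P)}$ messages for each user $k$, such that for almost every realization of the fading process there is $P_0$ such that for all $P\ge P_0$ the error probability of the codes, given that realization, tends to $0$ as $n\to\infty$. The codes can be chosen so that over each supersymbol the input is the sum of a fixed number of independently encoded scalar streams, each multiplied by a beamforming vector in $\mathbb K^{4}$ that depends only on the channel of user 1 in the first slot of that supersymbol, by a rule that is the same for all $P$ and $n$. -/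

import Mathlib

open MeasureTheory ProbabilityTheory Filter Topology

noncomputable section

namespace StaggeredBC

/-! Conventions: `𝕜` is `ℝ` or `ℂ`. Users are indexed by `Fin 2` (`0` is user 1, `1` is user 2),
transmit antennas by `Fin 2`. Time slots are `0, 1, 2, …`; the supersymbol `t` consists of the
slots `2 t` and `2 t + 1`. Logarithms are natural, so rates are in nats. -/

/-- A realization of the fading blocks: `g b k a` is the coefficient from transmit antenna `a` to
user `k` in the `b`-th coherence block of user `k`. -/
abbrev BlockStates (𝕜 : Type*) := ℕ → Fin 2 → Fin 2 → 𝕜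

/-- The coherence block of user `k` that contains the slot `s`. Both users have coherence time
`2`, with staggered boundaries: the blocks of user 1 are `{0}, {1, 2}, {3, 4}, …`, those of user 2
are `{0, 1}, {2, 3}, …`. So within a supersymbol the channel of user 1 changes and the channel of
user 2 does not. -/
def blockIndex (k : Fin 2) (s : ℕ) : ℕ := if k = 0 then (s + 1) / 2 else s / 2

/-- The channel vectors of both users in the slots `0, …, N - 1`. -/
def channel {𝕜 : Type*} (g : BlockStates 𝕜) (N : ℕ) : Fin 2 → Fin N → Fin 2 → 𝕜 :=
  fun k s => g (blockIndex k s) k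

/-- The random block states `g` on `(Ω, μ)` form a generic staggered block fading process: they
are stationary from block to block (with any dependence between blocks, users and antennas), and
the six coefficients that occur in one supersymbol (the two consecutive states of user 1 and the
one state of user 2) have a joint distribution that is absolutely continuous with respect to
Lebesgue (Haar) measure on `(𝕜²)³`. -/
structure IsGenericFading {𝕜 : Type*} [RCLike 𝕜] [MeasurableSpace 𝕜] [BorelSpace 𝕜]
    {Ω : Type*} [MeasurableSpace Ω] (μ : Measure Ω) (g : Ω → BlockStates 𝕜) : Prop where
  measurable : Measurable g
  stationary : μ.map (fun ω b => g ω (b + 1)) = μ.map g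
  generic : ∀ b : ℕ,
    μ.map (fun ω => (![g ω b 0, g ω (b + 1) 0, g ω b 1] : Fin 3 → Fin 2 → 𝕜)) ≪
      (Measure.addHaar : Measure (Fin 3 → Fin 2 → 𝕜))

/-- The law of one noise sample, of mean zero and `𝔼 |z|² = 1`: the standard Gaussian for `𝕜 = ℝ`
(where `RCLike.I = 0`), the circularly symmetric `𝒞𝒩(0, 1)` for `𝕜 = ℂ`. -/
def noise (𝕜 : Type*) [RCLike 𝕜] [MeasurableSpace 𝕜] : Measure 𝕜 :=
  ((gaussianReal 0 (1 / (Module.finrank ℝ 𝕜 : NNReal))).prod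
    (gaussianReal 0 (1 / (Module.finrank ℝ 𝕜 : NNReal)))).map
    (fun p : ℝ × ℝ => (p.1 : 𝕜) + (p.2 : 𝕜) * RCLike.I)

/-- A code of blocklength `N` for the broadcast channel with two transmit antennas and two
single-antenna users. There are `M k` messages for user `k`. The transmitter knows the channel of
user 1 (causally) and nothing about the realization of the channel of user 2; the receivers know
the channel states perfectly. -/
structure Code (𝕜 : Type*) [RCLike 𝕜] [MeasurableSpace 𝕜] (N : ℕ) where
  /-- numbers of messages -/
  M : Fin 2 → ℕ
  /-- encoder: messages ↦ channel of user 1 ↦ slot ↦ antenna ↦ input symbol -/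
  enc : (∀ k, Fin (M k)) → (Fin N → Fin 2 → 𝕜) → Fin N → Fin 2 → 𝕜
  measurable_enc : ∀ w, Measurable (enc w)
  causal : ∀ w (h h' : Fin N → Fin 2 → 𝕜) (s : Fin N), (∀ r ≤ s, h r = h' r) →
    enc w h s = enc w h' s
  /-- decoder of user `k`: channel states ↦ received sequence ↦ message estimate -/
  dec : ∀ k, (Fin 2 → Fin N → Fin 2 → 𝕜) → (Fin N → 𝕜) → Fin (M k)
  measurable_dec : ∀ k, Measurable (Function.uncurry (dec k))

section

variable {𝕜 : Type*} [RCLike 𝕜] [MeasurableSpace 𝕜] {N : ℕ}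

/-- The sequence received by user `k` for the channel `h`, messages `w` and noise `z`. -/
def Code.received (c : Code 𝕜 N) (h : Fin 2 → Fin N → Fin 2 → 𝕜) (w : ∀ k, Fin (c.M k))
    (z : Fin 2 → Fin N → 𝕜) (k : Fin 2) : Fin N → 𝕜 :=
  fun s => ∑ a, h k s a * c.enc w (h 0) s a + z k s

/-- The error probability (some user decodes wrongly) for the channel realization `h`, with
independent uniform messages and independent noise samples in all slots at both users. -/
def Code.errorProb (c : Code 𝕜 N) (h : Fin 2 → Fin N → Fin 2 → 𝕜) : ℝ :=
  (∑ w : (∀ k, Fin (c.M k)),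
    (Measure.pi fun _ : Fin 2 => Measure.pi fun _ : Fin N => noise 𝕜).real
      {z | ∃ k, c.dec k h (c.received h w z k) ≠ w k}) /
    Fintype.card (∀ k, Fin (c.M k))

/-- Average transmit power at most `P`, for all messages and all channel realizations. -/
def Code.PowerAtMost (c : Code 𝕜 N) (P : ℝ) : Prop :=
  ∀ w h, ∑ s, ∑ a, ‖c.enc w h s a‖ ^ 2 ≤ N * P

/-- The codes `C P n`, of blocklength `2 n` and power `P`, achieve almost surely `d k` degrees of
freedom for each user `k`: they have rates at least `R P k` (in nats per channel use) such that
`R P k / log P → d k` (`R P k / (½ log P) → d k` for `𝕜 = ℝ`), and for almost every realization of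
the fading process, for all large enough powers, the error probability tends to zero as
the blocklength grows. The codes may not depend on the fading realization except through `enc` and
`dec`. -/
def AchievesDoF {Ω : Type*} [MeasurableSpace Ω] (μ : Measure Ω)
    (g : Ω → BlockStates 𝕜) (C : ℝ → (n : ℕ) → Code 𝕜 (n * 2)) (d : Fin 2 → ℝ) : Prop :=
  (∀ P > 0, ∀ n, (C P n).PowerAtMost P) ∧
  (∃ R : ℝ → Fin 2 → ℝ,
    (∀ k, Tendsto (fun P => R P k / ((Module.finrank ℝ 𝕜 : ℝ) / 2 * Real.log P)) atTop
      (𝓝 (d k))) ∧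
    ∀ P > 0, ∀ n k, Real.exp ((n * 2 : ℕ) * R P k) ≤ (C P n).M k) ∧
  ∀ᵐ ω ∂μ, ∀ᶠ P in atTop,
    Tendsto (fun n => (C P n).errorProb (channel (g ω) (n * 2))) atTop (𝓝 0)

end

/-- Beamforming vectors over a two-slot supersymbol, for `L k` scalar streams of user `k`:
`beam k j v τ a` is the coefficient of stream `j` of user `k` in slot `τ` of the supersymbol on
antenna `a`, when `v` is the channel vector of user 1 in the first slot of that supersymbol. -/
structure Beamformer (𝕜 : Type*) [RCLike 𝕜] [MeasurableSpace 𝕜] (L : Fin 2 → ℕ) where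
  beam : ∀ k, Fin (L k) → (Fin 2 → 𝕜) → Fin 2 → Fin 2 → 𝕜
  measurable_beam : ∀ k j, Measurable (beam k j)

/-- The code `c` is linear beamforming with the vectors `B`: the message of user `k` is split into
one message for each of its `L k` streams, the streams are encoded independently by scalar
codebooks `u k j` (one scalar for each supersymbol), and the input over a supersymbol is the sum
of the stream symbols times the beamforming vectors. (`finProdFinEquiv (t, τ)` is the slot
`2 t + τ`.) -/
def Code.IsLinearBeamforming {𝕜 : Type*} [RCLike 𝕜] [MeasurableSpace 𝕜] {L : Fin 2 → ℕ} {n : ℕ}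
    (c : Code 𝕜 (n * 2)) (B : Beamformer 𝕜 L) : Prop :=
  ∃ (m : ∀ k, Fin (L k) → ℕ) (split : ∀ k, Fin (c.M k) ≃ ∀ j, Fin (m k j))
    (u : ∀ k j, Fin (m k j) → Fin n → 𝕜),
    ∀ w h t τ a, c.enc w h (finProdFinEquiv (t, τ)) a =
      ∑ k, ∑ j, B.beam k j (h (finProdFinEquiv (t, 0))) τ a * u k j (split k (w k) j) t

end StaggeredBC

end

/-!
Over each supersymbol, user 1 gets two streams, one from each antenna, repeated in both slots, and
user 2 gets one stream, sent in the first slot only along a vector orthogonal to the channel of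
user 1 in that slot. User 1 does not hear the stream of user 2 and resolves its own streams from its
two different channel vectors. User 2 has the same channel in both slots, so the difference of its
two samples is free of the streams of user 1. This gives three streams in two slots, with
`d = (1, 1/2)`.

The coding avoids random codebooks, so that one family of codes serves all realizations. Every
stream uses a Gilbert–Varshamov code over a lattice constellation of spacing `s`
(`exists_codebook`). In a supersymbol with a well-conditioned channel and no large noise sample, all
symbols are recovered correctly, so it is enough that the outer code corrects a small fraction
`1 / m` of supersymbols with large noise and a fraction `1 / m` of supersymbols with an
ill-conditioned channel (`eq_of_consistent`). More than a fraction `1 / m` of supersymbols with large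
noise is exponentially unlikely once the probability of a large sample is below `16⁻¹ ^ m`
(`measure_compl_typicalNoise_le`); only the tightness of the noise law matters. As the law of the
blocks is stationary, the maximal ergodic inequality bounds the probability that ill-conditioned
supersymbols ever have frequency above `1 / m` (`measure_exists_visits_le`), and genericity makes this
bound summable along `m = j + 3` for suitable thresholds `K j`, so that by Borel–Cantelli almost every
realization is fine for all large `j` (`IsGenericFading.exists_threshold`). Letting `j` grow slowly
with `P`, the rate of each stream is `(1 - o(1)) * dim 𝕜 * log √P` per supersymbol
(`tendsto_streamRate`).
-/

namespace StaggeredBC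

/-! ### The Gilbert–Varshamov bound -/

open Finset in
theorem card_hammingBall_le {α : Type*} [Fintype α] [DecidableEq α] [Nonempty α] {n : ℕ} (D : ℕ)
    (x : Fin n → α) :
    #{y : Fin n → α | hammingDist x y ≤ D} ≤ 2 ^ n * Fintype.card α ^ D := by
  classical
  have hsub : ({y : Fin n → α | hammingDist x y ≤ D} : Finset _) ⊆
      ({S : Finset (Fin n) | #S ≤ D} : Finset _).biUnion
        (fun S => Fintype.piFinset fun t => if t ∈ S then univ else {x t}) := by
    intro y hy
    simp only [mem_filter, mem_univ, true_and] at hy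
    simp only [mem_biUnion, mem_filter, mem_univ, true_and, Fintype.mem_piFinset]
    refine ⟨({i | x i ≠ y i} : Finset _), hy, fun t => ?_⟩
    by_cases h : x t = y t <;> simp [h]
  calc _ ≤ _ := card_le_card hsub
    _ ≤ #({S : Finset (Fin n) | #S ≤ D} : Finset _) * Fintype.card α ^ D := by
      refine card_biUnion_le_card_mul _ _ _ fun S hS => ?_
      rw [Fintype.card_piFinset]
      simp only [mem_filter, mem_univ, true_and] at hS
      have : ∀ t, #(if t ∈ S then (univ : Finset α) else {x t}) =
          if t ∈ S then Fintype.card α else 1 := by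
        intro t; split_ifs <;> simp
      simp only [this, prod_ite, prod_const, one_pow, mul_one]
      simp only [filter_mem_eq_inter, univ_inter]
      exact Nat.pow_le_pow_right Fintype.card_pos hS
    _ ≤ _ := by
      gcongr
      exact (card_le_univ _).trans (by simp)

open Finset in
/-- Gilbert–Varshamov: a code of maximal size among those with pairwise Hamming distances above `D`
has covering radius at most `D`, so its size is at least that of the space over that of a ball. -/
theorem exists_finset_hammingDist {α : Type*} [Fintype α] [DecidableEq α] [Nonempty α] (n D : ℕ) :
    ∃ C : Finset (Fin n → α), (∀ x ∈ C, ∀ y ∈ C, hammingDist x y ≤ D → x = y) ∧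
      Fintype.card α ^ n ≤ #C * (2 ^ n * Fintype.card α ^ D) := by
  classical
  obtain ⟨C, hC, hmax⟩ := exists_max_image
    ({C : Finset (Fin n → α) | ∀ x ∈ C, ∀ y ∈ C, hammingDist x y ≤ D → x = y} : Finset _) card
    ⟨∅, by simp⟩
  simp only [mem_filter, mem_univ, true_and] at hC hmax
  refine ⟨C, hC, ?_⟩
  have hcov : (univ : Finset (Fin n → α)) ⊆
      C.biUnion fun x => ({y : Fin n → α | hammingDist x y ≤ D} : Finset _) := by
    intro y _
    simp only [mem_biUnion, mem_filter, mem_univ, true_and]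
    by_contra! hy
    have hyC : y ∉ C := fun h => by simpa using hy y h
    have := hmax (insert y C) (by
      intro a ha b hb hab
      rw [mem_insert] at ha hb
      rcases ha with rfl | ha <;> rcases hb with rfl | hb
      · rfl
      · rw [hammingDist_comm] at hab
        exact absurd hab (not_le.2 (hy b hb))
      · exact absurd hab (not_le.2 (hy a ha))
      · exact hC a ha b hb hab)
    rw [card_insert_of_notMem hyC] at this
    omega
  calc Fintype.card α ^ n = #(univ : Finset (Fin n → α)) := by simp
    _ ≤ _ := card_le_card hcov
    _ ≤ _ := card_biUnion_le_card_mul _ _ _ fun x _ => card_hammingBall_le D x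

/-! ### The maximal ergodic inequality -/

/-- The maximum of the Birkhoff sums of `f` of lengths `0, …, N`, as a recursion on `N`. -/
def maxBirkhoffSum {X : Type*} (T : X → X) (f : X → ℝ) : ℕ → X → ℝ
  | 0, _ => 0
  | N + 1, x => max 0 (f x + maxBirkhoffSum T f N (T x))

section Maximal

variable {X : Type*} {T : X → X} {f : X → ℝ}

theorem maxBirkhoffSum_nonneg (N : ℕ) (x : X) : 0 ≤ maxBirkhoffSum T f N x := by
  cases N with
  | zero => exact le_rfl
  | succ N => exact le_max_left _ _

theorem maxBirkhoffSum_mono_succ (N : ℕ) (x : X) :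
    maxBirkhoffSum T f N x ≤ maxBirkhoffSum T f (N + 1) x := by
  induction N generalizing x with
  | zero => exact maxBirkhoffSum_nonneg _ _
  | succ N ih => exact max_le_max le_rfl (by linarith [ih (T x)])

theorem birkhoffSum_le_maxBirkhoffSum (N : ℕ) (x : X) :
    birkhoffSum T f N x ≤ maxBirkhoffSum T f N x := by
  induction N generalizing x with
  | zero => simp [maxBirkhoffSum]
  | succ N ih =>
    rw [birkhoffSum_succ']
    exact le_max_of_le_right (by linarith [ih (T x)])

variable [MeasurableSpace X] {ν : Measure X}

theorem measurable_maxBirkhoffSum (hT : Measurable T) (hf : Measurable f) (N : ℕ) :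
    Measurable (maxBirkhoffSum T f N) := by
  induction N with
  | zero => exact measurable_const
  | succ N ih => exact measurable_const.max (hf.add (ih.comp hT))

theorem integrable_maxBirkhoffSum (hT : MeasurePreserving T ν ν) (hf : Integrable f ν) (N : ℕ) :
    Integrable (maxBirkhoffSum T f N) ν := by
  induction N with
  | zero => exact integrable_zero _ _ _
  | succ N ih =>
    exact (integrable_zero X ℝ ν).sup (hf.add (hT.integrable_comp_of_integrable ih))

/-- Hopf's maximal ergodic lemma. Where `maxBirkhoffSum T f (N + 1)` is positive, it equals
`f + maxBirkhoffSum T f N ∘ T`, and the integral of the last term does not exceed that of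
`maxBirkhoffSum T f (N + 1)`. -/
theorem setIntegral_maxBirkhoffSum_pos_nonneg (hT : MeasurePreserving T ν ν) (hfm : Measurable f)
    (hf : Integrable f ν) (N : ℕ) :
    0 ≤ ∫ x in {x | 0 < maxBirkhoffSum T f (N + 1) x}, f x ∂ν := by
  set E := {x | 0 < maxBirkhoffSum T f (N + 1) x}
  have hE : MeasurableSet E :=
    measurableSet_lt measurable_const (measurable_maxBirkhoffSum hT.measurable hfm _)
  have hM := integrable_maxBirkhoffSum hT hf
  have hMT := hT.integrable_comp_of_integrable (hM N)
  have h1 : ∫ x in E, f x ∂ν =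
      ∫ x in E, maxBirkhoffSum T f (N + 1) x ∂ν - ∫ x in E, maxBirkhoffSum T f N (T x) ∂ν := by
    rw [← integral_sub (hM _).integrableOn (g := fun x => maxBirkhoffSum T f N (T x))
      hMT.integrableOn]
    refine setIntegral_congr_fun hE fun x hx => ?_
    have hx : 0 < max 0 (f x + maxBirkhoffSum T f N (T x)) := hx
    have : maxBirkhoffSum T f (N + 1) x = f x + maxBirkhoffSum T f N (T x) :=
      max_eq_right (by by_contra! h; rw [max_eq_left h.le] at hx; exact hx.false)
    simp [this]
  have h2 : ∫ x in E, maxBirkhoffSum T f (N + 1) x ∂ν = ∫ x, maxBirkhoffSum T f (N + 1) x ∂ν :=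
    setIntegral_eq_integral_of_forall_compl_eq_zero fun x hx =>
      le_antisymm (not_lt.1 hx) (maxBirkhoffSum_nonneg _ _)
  have h3 : ∫ x in E, maxBirkhoffSum T f N (T x) ∂ν ≤ ∫ x, maxBirkhoffSum T f N (T x) ∂ν :=
    setIntegral_le_integral hMT (ae_of_all _ fun x => maxBirkhoffSum_nonneg _ _)
  have h4 : ∫ x, maxBirkhoffSum T f N (T x) ∂ν = ∫ x, maxBirkhoffSum T f N x ∂ν := by
    have h := integral_map (μ := ν) (f := maxBirkhoffSum T f N) hT.measurable.aemeasurable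
      (measurable_maxBirkhoffSum hT.measurable hfm N).aestronglyMeasurable
    rw [hT.map_eq] at h
    exact h.symm
  have h5 : ∫ x, maxBirkhoffSum T f N x ∂ν ≤ ∫ x, maxBirkhoffSum T f (N + 1) x ∂ν :=
    integral_mono (hM _) (hM _) fun x => maxBirkhoffSum_mono_succ N x
  linarith

open Finset in
/-- The maximal ergodic inequality for visits: the probability that at some time the frequency of
visits to `B` exceeds `1 / m` is at most `m` times the probability of `B`. -/
theorem measure_exists_visits_le [IsProbabilityMeasure ν] (hT : MeasurePreserving T ν ν)
    {B : Set X} [DecidablePred (· ∈ B)] (hB : MeasurableSet B) {m : ℕ} (hm : 0 < m) :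
    ν {x | ∃ n, n < m * #{t ∈ range n | T^[t] x ∈ B}} ≤ m * ν B := by
  set f : X → ℝ := fun x => B.indicator 1 x - 1 / m with hfdef
  have hm' : (0 : ℝ) < m := by exact_mod_cast hm
  have hind : Integrable (B.indicator (1 : X → ℝ)) ν := (integrable_const (1 : ℝ)).indicator hB
  have hfm : Measurable f := (measurable_one.indicator hB).sub measurable_const
  have hf : Integrable f ν := hind.sub (integrable_const _)
  set E : ℕ → Set X := fun N => {x | 0 < maxBirkhoffSum T f N x}
  have hEm : ∀ N, MeasurableSet (E N) := fun N =>
    measurableSet_lt measurable_const (measurable_maxBirkhoffSum hT.measurable hfm _)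
  have hmono : Monotone E := monotone_nat_of_le_succ fun N x hx =>
    lt_of_lt_of_le (show 0 < maxBirkhoffSum T f N x from hx) (maxBirkhoffSum_mono_succ N x)
  have hsub : {x | ∃ n, n < m * #{t ∈ range n | T^[t] x ∈ B}} ⊆ ⋃ N, E N := by
    rintro x ⟨n, hn⟩
    refine Set.mem_iUnion.2 ⟨n, lt_of_lt_of_le ?_ (birkhoffSum_le_maxBirkhoffSum n x)⟩
    have hs : birkhoffSum T f n x = #{t ∈ range n | T^[t] x ∈ B} - n / m := by
      simp only [birkhoffSum, hfdef, sum_sub_distrib, sum_const, card_range, nsmul_eq_mul,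
        Set.indicator_apply, Pi.one_apply, sum_boole]
      ring
    have hn' : (n : ℝ) < m * #{t ∈ range n | T^[t] x ∈ B} := by exact_mod_cast hn
    rw [hs, sub_pos, div_lt_iff₀ hm']
    linarith
  have hle : ∀ N, ν (E N) ≤ m * ν B := by
    intro N
    refine (measure_mono (hmono N.le_succ)).trans ?_
    have h := setIntegral_maxBirkhoffSum_pos_nonneg hT hfm hf N
    change 0 ≤ ∫ x in E (N + 1), f x ∂ν at h
    rw [hfdef, integral_sub hind.integrableOn (integrable_const _), setIntegral_const,
      integral_indicator_one hB, smul_eq_mul] at h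
    have h1 : (ν.restrict (E (N + 1))).real B ≤ ν.real B :=
      ENNReal.toReal_mono (measure_ne_top _ _) (Measure.restrict_apply_le _ _)
    have h2 : ν.real (E (N + 1)) ≤ m * ν.real B := by
      have : ν.real (E (N + 1)) * (1 / m) ≤ ν.real B := by linarith
      rw [mul_one_div, div_le_iff₀ hm'] at this
      linarith
    rw [← ENNReal.toReal_le_toReal (measure_ne_top _ _)
      (ENNReal.mul_ne_top (ENNReal.natCast_ne_top _) (measure_ne_top _ _)), ENNReal.toReal_mul]
    simpa [Measure.real] using h2
  calc _ ≤ ν (⋃ N, E N) := measure_mono hsub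
    _ = ⨆ N, ν (E N) := hmono.measure_iUnion
    _ ≤ _ := iSup_le hle

end Maximal

/-! ### Genericity of the channel -/

/-- A set that meets every line in direction `e` in at most one point is Haar null: its translates
along such a line are disjoint. -/
theorem addHaar_eq_zero_of_line {E : Type*} [NormedAddCommGroup E] [NormedSpace ℝ E]
    [MeasurableSpace E] [BorelSpace E] [FiniteDimensional ℝ E] (ν : Measure E)
    [ν.IsAddHaarMeasure] {s : Set E} (hs : MeasurableSet s) (e : E)
    (h : ∀ x ∈ s, ∀ c : ℝ, x + c • e ∈ s → c = 0) : ν s = 0 := by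
  refine Measure.addHaar_eq_zero_of_disjoint_translates ν (fun n : ℕ => (1 / ((n : ℝ) + 1)) • e)
    ?_ ?_ hs
  · refine ((Metric.isBounded_closedBall (x := (0 : E)) (r := ‖e‖))).subset ?_
    rintro _ ⟨n, rfl⟩
    simp only [mem_closedBall_zero_iff, norm_smul]
    refine mul_le_of_le_one_left (norm_nonneg _) ?_
    rw [Real.norm_of_nonneg (by positivity), div_le_one (by positivity)]
    linarith [(Nat.cast_nonneg n : (0 : ℝ) ≤ n)]
  · intro i j hij
    refine Set.disjoint_left.2 ?_
    rintro _ hx hy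
    simp only [Set.singleton_add, Set.mem_image] at hx hy
    obtain ⟨x, hx, rfl⟩ := hx
    obtain ⟨y, hy, hxy⟩ := hy
    have hyx : y = x + (1 / ((i : ℝ) + 1) - 1 / ((j : ℝ) + 1)) • e := by
      rw [sub_smul, add_sub_assoc', eq_sub_iff_add_eq, add_comm x, add_comm y, hxy]
    have h0 := h x hx _ (hyx ▸ hy)
    have hi : (i : ℝ) + 1 ≠ 0 := by positivity
    have hj : (j : ℝ) + 1 ≠ 0 := by positivity
    field_simp at h0
    exact hij (by exact_mod_cast (by linarith : (i : ℝ) = j))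

/-- The determinant of the matrix with rows `v` and `w`. -/
def det₂ {𝕜 : Type*} [RCLike 𝕜] (v w : Fin 2 → 𝕜) : 𝕜 := v 0 * w 1 - v 1 * w 0

section
variable {𝕜 : Type*} [RCLike 𝕜] [MeasurableSpace 𝕜] [BorelSpace 𝕜]

theorem measurable_det₂ {X : Type*} [MeasurableSpace X] {v w : X → Fin 2 → 𝕜} (hv : Measurable v)
    (hw : Measurable w) : Measurable fun x => det₂ (v x) (w x) := by
  have hv' : ∀ a, Measurable fun x => v x a := measurable_pi_iff.1 hv
  have hw' : ∀ a, Measurable fun x => w x a := measurable_pi_iff.1 hw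
  unfold det₂
  fun_prop

theorem addHaar_det₂_eq_zero {ι : Type*} [Fintype ι] [DecidableEq ι] {i j : ι} (hij : i ≠ j) :
    (Measure.addHaar : Measure (ι → Fin 2 → 𝕜)) {x | det₂ (x i) (x j) = 0} = 0 := by
  have hi0 : Measurable fun x : ι → Fin 2 → 𝕜 => x i 0 := by fun_prop
  have hdet : Measurable fun x : ι → Fin 2 → 𝕜 => det₂ (x i) (x j) :=
    measurable_det₂ (measurable_pi_apply i) (measurable_pi_apply j)
  have hsub : {x : ι → Fin 2 → 𝕜 | det₂ (x i) (x j) = 0} ⊆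
      {x | x i 0 = 0} ∪ {x | x i 0 ≠ 0 ∧ det₂ (x i) (x j) = 0} := by
    intro x hx
    by_cases h : x i 0 = 0
    · exact Or.inl h
    · exact Or.inr ⟨h, hx⟩
  refine measure_mono_null hsub (measure_union_null ?_ ?_)
  · refine addHaar_eq_zero_of_line _ (hi0 (measurableSet_singleton 0))
      (Pi.single i (Pi.single 0 1)) fun x hx c hc => ?_
    simp only [Set.mem_ofPred_eq] at hx hc
    simpa [hx, RCLike.real_smul_eq_coe_mul] using hc
  · refine addHaar_eq_zero_of_line _
      ((hi0 (measurableSet_singleton 0)).compl.inter (hdet (measurableSet_singleton 0)))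
      (Pi.single j (Pi.single 1 1)) fun x hx c hc => ?_
    obtain ⟨hx0, hx⟩ := hx
    obtain ⟨-, hc⟩ := hc
    simp only [det₂, Pi.add_apply, Pi.smul_apply,
      Pi.single_eq_same, Pi.single_eq_of_ne hij, Pi.zero_apply, smul_zero, add_zero] at hx hc
    have h1 : x i 0 * (c : 𝕜) = 0 := by
      rw [RCLike.real_smul_eq_coe_mul] at hc
      simp at hc
      linear_combination hc - hx
    simpa using (mul_eq_zero.1 h1).resolve_left hx0

end

/-! ### Noise -/

section
variable {𝕜 : Type*} [RCLike 𝕜] [MeasurableSpace 𝕜] [BorelSpace 𝕜]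

instance : IsProbabilityMeasure (noise 𝕜) := by
  have h : Continuous fun p : ℝ × ℝ => (p.1 : 𝕜) + (p.2 : 𝕜) * RCLike.I := by fun_prop
  exact Measure.isProbabilityMeasure_map h.measurable.aemeasurable

variable (𝕜) in
theorem exists_noise_radius {ε : ENNReal} (hε : 0 < ε) :
    ∃ r : ℝ, 0 < r ∧ noise 𝕜 {z | r < ‖z‖} < ε := by
  have hm : ∀ n : ℕ, MeasurableSet {z : 𝕜 | (n : ℝ) + 1 < ‖z‖} := fun n =>
    measurableSet_lt measurable_const measurable_norm
  have ht := tendsto_measure_iInter_atTop (μ := noise 𝕜)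
    (s := fun n : ℕ => {z : 𝕜 | (n : ℝ) + 1 < ‖z‖}) (fun n => (hm n).nullMeasurableSet)
    (fun i j hij z (hz : (j : ℝ) + 1 < ‖z‖) => show (i : ℝ) + 1 < ‖z‖ by
      have : (i : ℝ) ≤ j := by exact_mod_cast hij
      linarith) ⟨0, measure_ne_top _ _⟩
  have he : ⋂ n : ℕ, {z : 𝕜 | (n : ℝ) + 1 < ‖z‖} = ∅ := by
    refine Set.eq_empty_of_forall_notMem fun z hz => ?_
    obtain ⟨n, hn⟩ := exists_nat_gt ‖z‖
    have : (n : ℝ) + 1 < ‖z‖ := Set.mem_iInter.1 hz n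
    linarith
  rw [he, measure_empty] at ht
  obtain ⟨n, hn⟩ := (ht.eventually_lt_const hε).exists
  exact ⟨n + 1, by positivity, hn⟩

open Finset in
/-- Union bound over the sets of slots in which the noise is large. -/
theorem pi_noise_many_large_le {m n : ℕ} {r : ℝ}
    (hr : noise 𝕜 {z | r < ‖z‖} ≤ (16⁻¹ : ENNReal) ^ m) :
    (Measure.pi fun _ : Fin (n * 2) => noise 𝕜)
      {z | n < m * #{s : Fin (n * 2) | r < ‖z s‖}} ≤ (4⁻¹ : ENNReal) ^ n := by
  classical
  set F : Finset (Finset (Fin (n * 2))) := {S | n < m * #S}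
  have hsub : {z : Fin (n * 2) → 𝕜 | n < m * #{s : Fin (n * 2) | r < ‖z s‖}} ⊆
      ⋃ S ∈ F, Set.univ.pi fun s => if s ∈ S then {z : 𝕜 | r < ‖z‖} else Set.univ := by
    intro z hz
    simp only [Set.mem_iUnion]
    refine ⟨({s : Fin (n * 2) | r < ‖z s‖} : Finset _), by simpa [F] using hz, fun s _ => ?_⟩
    by_cases h : r < ‖z s‖ <;> simp [h]
  have hS : ∀ S ∈ F, (Measure.pi fun _ : Fin (n * 2) => noise 𝕜)
      (Set.univ.pi fun s => if s ∈ S then {z : 𝕜 | r < ‖z‖} else Set.univ) ≤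
        (16⁻¹ : ENNReal) ^ n := by
    intro S hS
    rw [Measure.pi_pi]
    have : ∀ s, noise 𝕜 (if s ∈ S then {z : 𝕜 | r < ‖z‖} else Set.univ) =
        if s ∈ S then noise 𝕜 {z : 𝕜 | r < ‖z‖} else 1 := by
      intro s; split_ifs <;> simp
    simp only [this, prod_ite, prod_const, one_pow, mul_one, filter_mem_eq_inter, univ_inter]
    calc _ ≤ ((16⁻¹ : ENNReal) ^ m) ^ #S := by gcongr
      _ = (16⁻¹ : ENNReal) ^ (m * #S) := (pow_mul _ _ _).symm
      _ ≤ _ := pow_le_pow_right_of_le_one' (by simp) (mem_filter.1 hS).2.le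
  have hcard : (#F : ENNReal) ≤ 4 ^ n := by
    have : #F ≤ 4 ^ n := (card_le_univ _).trans (by simp [mul_comm n 2, pow_mul])
    exact_mod_cast this
  have h4 : (4 : ENNReal) * 16⁻¹ = 4⁻¹ := by
    rw [show (16 : ENNReal) = 4 * 4 by norm_num, ENNReal.mul_inv (by simp) (by simp), ← mul_assoc,
      ENNReal.mul_inv_cancel (by simp) (by simp), one_mul]
  calc _ ≤ _ := measure_mono hsub
    _ ≤ ∑ S ∈ F, _ := measure_biUnion_finset_le _ _
    _ ≤ ∑ _S ∈ F, (16⁻¹ : ENNReal) ^ n := sum_le_sum hS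
    _ = #F * (16⁻¹ : ENNReal) ^ n := by rw [sum_const, nsmul_eq_mul]
    _ ≤ 4 ^ n * (16⁻¹ : ENNReal) ^ n := by gcongr
    _ = _ := by rw [← mul_pow, h4]

open Finset in
/-- The set of noise realizations for which, at both users, all but a fraction `1 / m` of the
supersymbols are free of noise samples larger than `r`. -/
def typicalNoise (𝕜 : Type*) [RCLike 𝕜] (n m : ℕ) (r : ℝ) : Set (Fin 2 → Fin (n * 2) → 𝕜) :=
  {z | ∀ k, m * #{s : Fin (n * 2) | r < ‖z k s‖} ≤ n}

open Finset in
theorem measure_compl_typicalNoise_le {m n : ℕ} {r : ℝ}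
    (hr : noise 𝕜 {z | r < ‖z‖} ≤ (16⁻¹ : ENNReal) ^ m) :
    (Measure.pi fun _ : Fin 2 => Measure.pi fun _ : Fin (n * 2) => noise 𝕜)
      (typicalNoise 𝕜 n m r)ᶜ ≤ 2 * (4⁻¹ : ENNReal) ^ n := by
  set A : Set (Fin (n * 2) → 𝕜) := {z | n < m * #{s : Fin (n * 2) | r < ‖z s‖}} with hA
  have hAm : MeasurableSet A := by
    have : Measurable fun z : Fin (n * 2) → 𝕜 => #{s : Fin (n * 2) | r < ‖z s‖} := by
      simp only [card_filter]
      refine Finset.measurable_sum _ fun s _ => Measurable.ite ?_ measurable_const measurable_const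
      exact measurableSet_lt measurable_const (measurable_pi_apply s).norm
    exact measurableSet_lt measurable_const (this.const_mul m)
  have hsub : (typicalNoise 𝕜 n m r)ᶜ ⊆ ⋃ k : Fin 2, Function.eval k ⁻¹' A := by
    intro z hz
    simp only [typicalNoise, Set.mem_compl_iff, Set.mem_ofPred_eq, not_forall, not_le] at hz
    simpa [A] using hz
  refine (measure_mono hsub).trans ((measure_iUnion_fintype_le _ _).trans ?_)
  have hk : ∀ k : Fin 2, (Measure.pi fun _ : Fin 2 => Measure.pi fun _ : Fin (n * 2) => noise 𝕜)
      (Function.eval k ⁻¹' A) ≤ (4⁻¹ : ENNReal) ^ n := fun k => by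
    rw [(measurePreserving_eval _ k).measure_preimage hAm.nullMeasurableSet]
    exact pi_noise_many_large_le hr
  refine (Finset.sum_le_sum fun k _ => hk k).trans ?_
  simp

end

/-! ### Codebooks -/

section
variable {𝕜 : Type*} [RCLike 𝕜]

variable (𝕜) in
/-- Lattice constellations, given by integer coordinates in `{0, …, q}` with respect to a basis
over `ℝ`. -/
theorem exists_constellation : ∃ c : ℝ, 1 ≤ c ∧ ∀ (q : ℕ) (s : ℝ), 0 < s →
    ∃ φ : (Fin (Module.finrank ℝ 𝕜) → Fin (q + 1)) → 𝕜, (∀ x, ‖φ x‖ ≤ c * s * q) ∧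
      ∀ x y, ‖φ x - φ y‖ < s → x = y := by
  set e : 𝕜 ≃L[ℝ] (Fin (Module.finrank ℝ 𝕜) → ℝ) := (Module.finBasis ℝ 𝕜).equivFunL
  set a := ‖(e : 𝕜 →L[ℝ] (Fin (Module.finrank ℝ 𝕜) → ℝ))‖
  set b := ‖(e.symm : (Fin (Module.finrank ℝ 𝕜) → ℝ) →L[ℝ] 𝕜)‖
  have ha : 0 ≤ a := norm_nonneg _
  have hb : 0 ≤ b := norm_nonneg _
  refine ⟨(b + 1) * (a + 1), by nlinarith, fun q s hs =>
    ⟨fun x => e.symm ((s * (a + 1)) • fun i => ((x i : ℕ) : ℝ)), fun x => ?_, fun x y hxy => ?_⟩⟩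
  · refine ((e.symm : (Fin (Module.finrank ℝ 𝕜) → ℝ) →L[ℝ] 𝕜).le_opNorm _).trans ?_
    rw [norm_smul, Real.norm_of_nonneg (by positivity)]
    have hx : ‖fun i => ((x i : ℕ) : ℝ)‖ ≤ q := by
      refine (pi_norm_le_iff_of_nonneg (by positivity)).2 fun i => ?_
      rw [Real.norm_of_nonneg (by positivity)]
      exact_mod_cast Nat.lt_succ_iff.1 (x i).2
    calc b * (s * (a + 1) * _) ≤ (b + 1) * (s * (a + 1) * q) := by gcongr; linarith
      _ = _ := by ring
  · rw [← map_sub, ← smul_sub] at hxy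
    set v : Fin (Module.finrank ℝ 𝕜) → ℝ := (fun i => ((x i : ℕ) : ℝ)) - fun i => ((y i : ℕ) : ℝ)
      with hv
    have h1 := (e : 𝕜 →L[ℝ] (Fin (Module.finrank ℝ 𝕜) → ℝ)).le_opNorm
      (e.symm ((s * (a + 1)) • v))
    simp only [ContinuousLinearEquiv.coe_coe, ContinuousLinearEquiv.apply_symm_apply, norm_smul,
      Real.norm_of_nonneg (show 0 ≤ s * (a + 1) by positivity)] at h1
    have h2 : ‖v‖ < 1 := by
      have h3 : s * (a + 1) * ‖v‖ ≤ a * s := h1.trans (by gcongr)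
      by_contra! h
      nlinarith [mul_le_mul_of_nonneg_left h (show 0 ≤ s * (a + 1) by positivity)]
    ext i
    have h3 : |((x i : ℕ) : ℝ) - ((y i : ℕ) : ℝ)| < 1 := (norm_le_pi_norm v i).trans_lt h2
    have h4 : |((x i : ℕ) : ℤ) - ((y i : ℕ) : ℤ)| < 1 := by exact_mod_cast h3
    have h5 := Int.abs_lt_one_iff.1 h4
    omega

open Finset in
variable (𝕜) in
/-- Codebooks with entries bounded by `√P / 3`, in which two different words differ by at least
`s` in more than a fraction `3 / m` of the positions. For fixed `s` and `m` the exponential rate is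
about `(1 - 3 / m) * dim 𝕜 * log √P`. -/
theorem exists_codebook : ∃ c : ℝ, 1 ≤ c ∧ ∀ (s P : ℝ) (m n : ℕ), 0 < s → 3 ≤ m →
    ∃ (M : ℕ) (ψ : Fin M → Fin n → 𝕜), (∀ w t, ‖ψ w t‖ ≤ √P / 3) ∧
      (∀ w w', m * #{t | s ≤ ‖ψ w t - ψ w' t‖} ≤ 3 * n → w = w') ∧ 0 < M ∧
      (0 < P → Real.exp (n * ((1 - 3 / m) * (Module.finrank ℝ 𝕜 *
        (Real.log P / 2 - Real.log (3 * c * s))) - Real.log 2)) ≤ M) := by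
  obtain ⟨c, hc1, hc⟩ := exists_constellation 𝕜
  refine ⟨c, hc1, fun s P m n hs hm => ?_⟩
  have hm0 : (0 : ℝ) < m := by exact_mod_cast (by omega : 0 < m)
  have hcs : 0 < 3 * c * s := by positivity
  set q := ⌊√P / (3 * c * s)⌋₊ with hq
  obtain ⟨φ, hφ, hφs⟩ := hc q s hs
  obtain ⟨C, hC, hcard⟩ := exists_finset_hammingDist
    (α := Fin (Module.finrank ℝ 𝕜) → Fin (q + 1)) n (3 * n / m)
  have hM : 0 < #C := by
    have h1 : 0 < Fintype.card (Fin (Module.finrank ℝ 𝕜) → Fin (q + 1)) ^ n :=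
      pow_pos Fintype.card_pos _
    by_contra! h
    rw [Nat.le_zero.1 h, zero_mul] at hcard
    omega
  refine ⟨#C, fun w t => φ ((C.equivFin.symm w : Fin n → _) t), fun w t => ?_, fun w w' h => ?_,
    hM, fun hP => ?_⟩
  · refine (hφ _).trans ?_
    have h1 : (q : ℝ) ≤ √P / (3 * c * s) := Nat.floor_le (by positivity)
    rw [le_div_iff₀ hcs] at h1
    linarith
  · refine C.equivFin.symm.injective (Subtype.ext (hC _ (Subtype.prop _) _ (Subtype.prop _) ?_))
    rw [Nat.le_div_iff_mul_le (by omega), mul_comm]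
    refine le_trans (Nat.mul_le_mul_left m ?_) h
    refine card_le_card fun t => ?_
    simp only [mem_filter, mem_univ, true_and]
    intro ht
    by_contra! hlt
    exact ht (hφs _ _ hlt)
  · rw [← Real.le_log_iff_exp_le (by exact_mod_cast hM)]
    have hQ : Fintype.card (Fin (Module.finrank ℝ 𝕜) → Fin (q + 1)) =
      (q + 1) ^ Module.finrank ℝ 𝕜 := by simp
    clear_value q
    generalize Module.finrank ℝ 𝕜 = d at *
    rw [hQ] at hcard
    have hcard' : (((q : ℝ) + 1) ^ d) ^ n ≤ #C * (2 ^ n * (((q : ℝ) + 1) ^ d) ^ (3 * n / m)) := by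
      exact_mod_cast hcard
    have hq1 : (0 : ℝ) < q + 1 := by positivity
    have hM' : (0 : ℝ) < #C := by exact_mod_cast hM
    have hlog := Real.log_le_log (by positivity) hcard'
    rw [Real.log_mul (by positivity) (by positivity), Real.log_mul (by positivity) (by positivity)]
      at hlog
    simp only [Real.log_pow] at hlog
    set ℓ := Real.log ((q : ℝ) + 1)
    have hℓ0 : 0 ≤ ℓ := Real.log_nonneg (by linarith [(Nat.cast_nonneg q : (0 : ℝ) ≤ q)])
    have hℓ : Real.log P / 2 - Real.log (3 * c * s) ≤ ℓ := by
      rw [← Real.log_sqrt hP.le, ← Real.log_div (Real.sqrt_pos.2 hP).ne' hcs.ne']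
      refine Real.log_le_log (div_pos (Real.sqrt_pos.2 hP) hcs) ?_
      rw [hq]
      exact (Nat.lt_floor_add_one _).le
    have hD : ((3 * n / m : ℕ) : ℝ) ≤ 3 * n / m := by
      simpa using (Nat.cast_div_le (m := 3 * n) (n := m) : _ ≤ ((3 * n : ℕ) : ℝ) / m)
    have h3 : 0 ≤ 1 - 3 / (m : ℝ) := by
      rw [sub_nonneg, div_le_one hm0]
      exact_mod_cast hm
    have hd : 0 ≤ (d : ℝ) * ℓ := by positivity
    calc _ ≤ (n : ℝ) * ((1 - 3 / m) * (d * ℓ) - Real.log 2) := by gcongr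
      _ = n * (d * ℓ) - 3 * n / m * (d * ℓ) - n * Real.log 2 := by ring
      _ ≤ n * (d * ℓ) - ((3 * n / m : ℕ) : ℝ) * (d * ℓ) - n * Real.log 2 := by gcongr
      _ ≤ _ := by linarith

end

/-! ### The beamforming scheme over one supersymbol -/

/-- Two streams for user 1, one for user 2. -/
def streamCount : Fin 2 → ℕ := ![2, 1]

section
variable {𝕜 : Type*} [RCLike 𝕜]

/-- A vector `w` with coordinates at most `1` in absolute value and `∑ a, v a * w a = 0` (the
bilinear pairing, as in the channel), normalized without division by zero. -/
def zeroForcing (v : Fin 2 → 𝕜) (a : Fin 2) : 𝕜 :=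
  ((1 + ‖v 0‖ + ‖v 1‖ : ℝ) : 𝕜)⁻¹ * ![-v 1, v 0] a

/-- Stream `j` of user 1 is sent from antenna `j` in both slots, so that it arrives at user 2
in the direction `(1, 1)`; the stream of user 2 is sent in the first slot only, invisibly to user
1. -/
def beamVector (k : Fin 2) (j : Fin (streamCount k)) (v : Fin 2 → 𝕜) (τ a : Fin 2) : 𝕜 :=
  if k = 0 then if (a : ℕ) = j then 1 else 0 else if τ = 0 then zeroForcing v a else 0

/-- The noiseless contribution of the streams `u` of user `k`, in the slot `τ` of a supersymbol, to
the signal received through the channel `H`; the channel of user 1 in the first slot is `v`. -/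
def blockSignal (k : Fin 2) (v : Fin 2 → 𝕜) (H : Fin 2 → Fin 2 → 𝕜)
    (u : Fin (streamCount k) → 𝕜) (τ : Fin 2) : 𝕜 :=
  ∑ a, H τ a * ∑ j, beamVector k j v τ a * u j

/-- What the receivers keep of a supersymbol `y`: user 1 keeps both samples (indexed by `i`), user
2 keeps their difference (for either value of `i`). -/
def project (k i : Fin 2) (y : Fin 2 → 𝕜) : 𝕜 := if k = 0 then y i else y 0 - y 1

/-- The channel states `v, v'` of user 1 and `f` of user 2 in a supersymbol allow both users to
invert their channels with noise amplification at most `K`. -/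
def GoodChannel (K : ℝ) (v v' f : Fin 2 → 𝕜) : Prop :=
  1 + ‖v 0‖ + ‖v 1‖ + ‖v' 0‖ + ‖v' 1‖ ≤ K * ‖det₂ v v'‖ ∧
    1 + ‖v 0‖ + ‖v 1‖ + ‖v' 0‖ + ‖v' 1‖ ≤ K * ‖det₂ v f‖

theorem norm_zeroForcing_le (v : Fin 2 → 𝕜) (a : Fin 2) : ‖zeroForcing v a‖ ≤ 1 := by
  have h : 0 < 1 + ‖v 0‖ + ‖v 1‖ := by positivity
  rw [zeroForcing, norm_mul, norm_inv, RCLike.norm_ofReal, abs_of_pos h, inv_mul_le_iff₀ h]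
  fin_cases a <;> simp <;> linarith [norm_nonneg (v 0), norm_nonneg (v 1)]

theorem sum_mul_zeroForcing (v f : Fin 2 → 𝕜) :
    ∑ a, f a * zeroForcing v a = ((1 + ‖v 0‖ + ‖v 1‖ : ℝ) : 𝕜)⁻¹ * det₂ v f := by
  simp only [Fin.sum_univ_two, zeroForcing, det₂, Matrix.cons_val_zero, Matrix.cons_val_one]
  ring

theorem blockSignal_zero (v : Fin 2 → 𝕜) (H : Fin 2 → Fin 2 → 𝕜) (u : Fin (streamCount 0) → 𝕜)
    (τ : Fin 2) : blockSignal 0 v H u τ = H τ 0 * u (0 : Fin 2) + H τ 1 * u (1 : Fin 2) := by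
  have h (a : Fin 2) : ∑ j, beamVector 0 j v τ a * u j = u a := by
    change ∑ j : Fin 2, (if (a : ℕ) = j then (1 : 𝕜) else 0) * u j = u a
    fin_cases a <;> simp [Fin.sum_univ_two]
  simp only [blockSignal, h, Fin.sum_univ_two]

theorem blockSignal_one (v : Fin 2 → 𝕜) (H : Fin 2 → Fin 2 → 𝕜) (u : Fin (streamCount 1) → 𝕜)
    (τ : Fin 2) : blockSignal 1 v H u τ =
      if τ = 0 then ((1 + ‖v 0‖ + ‖v 1‖ : ℝ) : 𝕜)⁻¹ * det₂ v (H 0) * u (0 : Fin 1) else 0 := by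
  have h (a : Fin 2) : ∑ j, beamVector 1 j v τ a * u j =
      (if τ = 0 then zeroForcing v a else 0) * u (0 : Fin 1) := by
    change ∑ j : Fin 1, (if τ = 0 then zeroForcing v a else 0) * u j = _
    simp
  simp only [blockSignal, h]
  split_ifs with hτ
  · simp only [hτ, ← sum_mul_zeroForcing, Finset.sum_mul, mul_assoc]
  · simp

theorem blockSignal_sub (k : Fin 2) (v : Fin 2 → 𝕜) (H : Fin 2 → Fin 2 → 𝕜)
    (u u' : Fin (streamCount k) → 𝕜) (τ : Fin 2) :
    blockSignal k v H u τ - blockSignal k v H u' τ = blockSignal k v H (u - u') τ := by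
  simp only [blockSignal, Pi.sub_apply, mul_sub, Finset.sum_sub_distrib]

theorem project_add (k i : Fin 2) (y y' : Fin 2 → 𝕜) :
    project k i (y + y') = project k i y + project k i y' := by
  unfold project
  split_ifs
  · rfl
  · simp only [Pi.add_apply]; ring

theorem project_sub (k i : Fin 2) (y y' : Fin 2 → 𝕜) :
    project k i (y - y') = project k i y - project k i y' := by
  unfold project
  split_ifs
  · rfl
  · simp only [Pi.sub_apply]; ring

theorem norm_project_le (k i : Fin 2) {y : Fin 2 → 𝕜} {r : ℝ} (hr : 0 ≤ r)
    (hy : ∀ τ, ‖y τ‖ ≤ r) : ‖project k i y‖ ≤ 2 * r := by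
  unfold project
  split_ifs
  · linarith [hy i]
  · linarith [norm_sub_le (y 0) (y 1), hy 0, hy 1]

/-- The stream of user 2 is zero-forced at user 1. -/
theorem project_zero_blockSignal_one {v : Fin 2 → 𝕜} {H : Fin 2 → Fin 2 → 𝕜} (hH : H 0 = v)
    (u : Fin (streamCount 1) → 𝕜) (i : Fin 2) : project 0 i (blockSignal 1 v H u) = 0 := by
  simp only [project, if_true, blockSignal_one, hH]
  simp [det₂, mul_comm]

/-- The streams of user 1 are aligned at user 2, whose channel is constant. -/
theorem project_one_blockSignal_zero (v : Fin 2 → 𝕜) {H : Fin 2 → Fin 2 → 𝕜} (hH : H 0 = H 1)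
    (u : Fin (streamCount 0) → 𝕜) (i : Fin 2) : project 1 i (blockSignal 0 v H u) = 0 := by
  simp [project, blockSignal_zero, hH]

/-- Cramer's rule: user 1 resolves its two streams from the two samples. -/
theorem norm_stream_zero_le {K r : ℝ} {v v' f : Fin 2 → 𝕜}
    (hg : GoodChannel K v v' f) {u : Fin (streamCount 0) → 𝕜}
    (hu : ∀ i, ‖project 0 i (blockSignal 0 v ![v, v'] u)‖ ≤ r) (j : Fin (streamCount 0)) :
    ‖u j‖ ≤ r * K := by
  have h0 := hu 0
  have h1 := hu 1
  have hr : 0 ≤ r := (norm_nonneg _).trans h0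
  simp only [project, if_true, blockSignal_zero, Matrix.cons_val_zero, Matrix.cons_val_one]
    at h0 h1
  have hd : 0 < ‖det₂ v v'‖ := by
    refine (norm_nonneg _).lt_of_ne fun h => ?_
    have := hg.1
    rw [← h, mul_zero] at this
    linarith [norm_nonneg (v 0), norm_nonneg (v 1), norm_nonneg (v' 0), norm_nonneg (v' 1)]
  have key (x : 𝕜) (b b' : 𝕜) (hb : ‖b‖ ≤ ‖v 0‖ + ‖v 1‖) (hb' : ‖b'‖ ≤ ‖v' 0‖ + ‖v' 1‖)
      (hx : det₂ v v' * x = b' * (v 0 * u (0 : Fin 2) + v 1 * u (1 : Fin 2)) -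
        b * (v' 0 * u (0 : Fin 2) + v' 1 * u (1 : Fin 2))) : ‖x‖ ≤ r * K := by
    have h2 : ‖det₂ v v'‖ * ‖x‖ ≤ ‖det₂ v v'‖ * (r * K) := by
      rw [← norm_mul, hx]
      refine (norm_sub_le _ _).trans ?_
      rw [norm_mul, norm_mul]
      calc _ ≤ (‖v' 0‖ + ‖v' 1‖) * r + (‖v 0‖ + ‖v 1‖) * r := by gcongr
        _ ≤ (1 + ‖v 0‖ + ‖v 1‖ + ‖v' 0‖ + ‖v' 1‖) * r := by linarith
        _ ≤ (K * ‖det₂ v v'‖) * r := by gcongr; exact hg.1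
        _ = _ := by ring
    exact le_of_mul_le_mul_left h2 hd
  have hv0 := norm_nonneg (v 0)
  have hv1 := norm_nonneg (v 1)
  have hv0' := norm_nonneg (v' 0)
  have hv1' := norm_nonneg (v' 1)
  change Fin 2 at j
  fin_cases j
  · exact key (u (0 : Fin 2)) (v 1) (v' 1) (by linarith) (by linarith) (by rw [det₂]; ring)
  · refine key (u (1 : Fin 2)) (-v 0) (-v' 0) (by rw [norm_neg]; linarith)
      (by rw [norm_neg]; linarith) (by rw [det₂]; ring)

theorem norm_stream_one_le {K r : ℝ} {v v' f : Fin 2 → 𝕜}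
    (hg : GoodChannel K v v' f) {u : Fin (streamCount 1) → 𝕜}
    (hu : ∀ i, ‖project 1 i (blockSignal 1 v ![f, f] u)‖ ≤ r) (j : Fin (streamCount 1)) :
    ‖u j‖ ≤ r * K := by
  have h0 := hu 0
  have hr : 0 ≤ r := (norm_nonneg _).trans h0
  have hN : 0 < 1 + ‖v 0‖ + ‖v 1‖ := by positivity
  simp only [project, one_ne_zero, if_false, if_true, blockSignal_one, Matrix.cons_val_zero,
    sub_zero] at h0
  rw [norm_mul, norm_mul, norm_inv, RCLike.norm_ofReal, abs_of_pos hN, mul_assoc,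
    inv_mul_le_iff₀ hN] at h0
  have hd : 0 < ‖det₂ v f‖ := by
    refine (norm_nonneg _).lt_of_ne fun h => ?_
    have := hg.2
    rw [← h, mul_zero] at this
    linarith [norm_nonneg (v' 0), norm_nonneg (v' 1)]
  change Fin 1 at j
  obtain rfl : j = 0 := Subsingleton.elim _ _
  have h2 : ‖det₂ v f‖ * ‖u (0 : Fin 1)‖ ≤ ‖det₂ v f‖ * (r * K) := by
    refine h0.trans ?_
    calc (1 + ‖v 0‖ + ‖v 1‖) * r ≤ (K * ‖det₂ v f‖) * r := by
          gcongr
          linarith [hg.2, norm_nonneg (v' 0), norm_nonneg (v' 1)]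
      _ = _ := by ring
  exact le_of_mul_le_mul_left h2 hd

end

section
variable {𝕜 : Type*} [RCLike 𝕜] [MeasurableSpace 𝕜] [BorelSpace 𝕜]

theorem measurable_zeroForcing (a : Fin 2) :
    Measurable fun v : Fin 2 → 𝕜 => zeroForcing v a := by
  have h : Measurable fun v : Fin 2 → 𝕜 => ((1 + ‖v 0‖ + ‖v 1‖ : ℝ) : 𝕜)⁻¹ :=
    (RCLike.continuous_ofReal.measurable.comp (((measurable_pi_apply (0 : Fin 2)).norm.const_add 1).add
      (measurable_pi_apply (1 : Fin 2)).norm)).inv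
  refine h.mul ?_
  fin_cases a
  · exact (measurable_pi_apply 1).neg
  · exact measurable_pi_apply 0

theorem measurable_beamVector (k : Fin 2) (j : Fin (streamCount k)) (τ a : Fin 2) :
    Measurable fun v : Fin 2 → 𝕜 => beamVector k j v τ a := by
  unfold beamVector
  split_ifs
  · exact measurable_const
  · exact measurable_const
  · exact measurable_zeroForcing a
  · exact measurable_const

variable (𝕜) in
/-- The beamforming vectors of the scheme. -/
def beamformer : Beamformer 𝕜 streamCount where
  beam := beamVector
  measurable_beam k j := measurable_pi_iff.2 fun τ => measurable_pi_iff.2 fun a =>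
    measurable_beamVector k j τ a

theorem measurable_blockSignal {X : Type*} [MeasurableSpace X] (k : Fin 2) {v : X → Fin 2 → 𝕜}
    {H : X → Fin 2 → Fin 2 → 𝕜} (hv : Measurable v) (hH : Measurable H)
    (u : Fin (streamCount k) → 𝕜) (τ : Fin 2) :
    Measurable fun x => blockSignal k (v x) (H x) u τ := by
  refine Finset.measurable_sum _ fun a _ => Measurable.mul ?_ ?_
  · exact measurable_pi_iff.1 (measurable_pi_iff.1 hH τ) a
  · exact Finset.measurable_sum _ fun j _ =>
      ((measurable_beamVector k j τ a).comp hv).mul_const _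

theorem measurable_project (k i : Fin 2) : Measurable (project k i : (Fin 2 → 𝕜) → 𝕜) := by
  unfold project
  split_ifs
  · exact measurable_pi_apply i
  · exact (measurable_pi_apply 0).sub (measurable_pi_apply 1)

theorem measurableSet_goodChannel {X : Type*} [MeasurableSpace X] (K : ℝ) {v v' f : X → Fin 2 → 𝕜}
    (hv : Measurable v) (hv' : Measurable v') (hf : Measurable f) :
    MeasurableSet {x | GoodChannel K (v x) (v' x) (f x)} := by
  have h1 (a) : Measurable fun x => ‖v x a‖ := (measurable_pi_iff.1 hv a).norm
  have h2 (a) : Measurable fun x => ‖v' x a‖ := (measurable_pi_iff.1 hv' a).norm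
  have hs : Measurable fun x => 1 + ‖v x 0‖ + ‖v x 1‖ + ‖v' x 0‖ + ‖v' x 1‖ :=
    ((((h1 0).const_add 1).add (h1 1)).add (h2 0)).add (h2 1)
  exact (measurableSet_le hs ((measurable_det₂ hv hv').norm.const_mul K)).inter
    (measurableSet_le hs ((measurable_det₂ hv hf).norm.const_mul K))

end

/-! ### The codes -/

/-- The samples of a supersymbol, extracted from those of the slots `0, …, 2 n - 1`. -/
def block {α : Type*} {n : ℕ} (y : Fin (n * 2) → α) (t : Fin n) (τ : Fin 2) : α :=
  y (finProdFinEquiv (t, τ))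

theorem measurable_block {α : Type*} [MeasurableSpace α] {n : ℕ} (t : Fin n) :
    Measurable fun y : Fin (n * 2) → α => block y t :=
  measurable_pi_iff.2 fun _ => measurable_pi_apply _

section
variable {𝕜 : Type*} [RCLike 𝕜] {M n : ℕ}

/-- The stream symbols in supersymbol `t` for the message `w` of user `k`, which is a tuple of
messages for the streams; all streams use the codebook `ψ`. -/
def streamSymbols (ψ : Fin M → Fin n → 𝕜) (k : Fin 2) (w : Fin (M ^ streamCount k)) (t : Fin n)
    (j : Fin (streamCount k)) : 𝕜 :=
  ψ (finFunctionFinEquiv.symm w j) t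

/-- The contribution of the message of user `k` to what that user receives in supersymbol `t`. -/
def ownSignal (ψ : Fin M → Fin n → 𝕜) (k : Fin 2) (h : Fin 2 → Fin (n * 2) → Fin 2 → 𝕜)
    (w : Fin (M ^ streamCount k)) (t : Fin n) : Fin 2 → 𝕜 :=
  blockSignal k (block (h 0) t 0) (block (h k) t) (streamSymbols ψ k w t)

open Finset in
/-- The message `w` explains the received sequence `y` of user `k` up to noise of size `r`, except
in a fraction `1 / m` of the supersymbols. -/
def Consistent (ψ : Fin M → Fin n → 𝕜) (m : ℕ) (r : ℝ) (k : Fin 2)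
    (h : Fin 2 → Fin (n * 2) → Fin 2 → 𝕜) (y : Fin (n * 2) → 𝕜) (w : Fin (M ^ streamCount k)) :
    Prop :=
  m * #{t | ∃ i, 2 * r < ‖project k i (block y t - ownSignal ψ k h w t)‖} ≤ n

open Classical in
/-- Some message that satisfies `p`, if there is one. -/
noncomputable def chooseMessage {N : ℕ} (hN : 0 < N) (p : Fin N → Prop) : Fin N :=
  if h : ∃ w, p w then h.choose else ⟨0, hN⟩

theorem chooseMessage_eq {N : ℕ} (hN : 0 < N) {p : Fin N → Prop} {w : Fin N} (hw : p w)
    (huniq : ∀ w', p w' → w' = w) : chooseMessage hN p = w := by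
  have h : ∃ w, p w := ⟨w, hw⟩
  rw [chooseMessage, dif_pos h]
  exact huniq _ h.choose_spec

open Finset in
open scoped Classical in
/-- Two messages that are consistent with the same received sequence have stream words that are
close in all supersymbols with a good channel in which both messages explain the samples: in all
but a fraction `3 / m`. -/
theorem eq_of_consistent {ψ : Fin M → Fin n → 𝕜} {m : ℕ} {r s K : ℝ} (hs : 4 * r * K < s)
    (hψ : ∀ w w', m * #{t | s ≤ ‖ψ w t - ψ w' t‖} ≤ 3 * n → w = w')
    {h : Fin 2 → Fin (n * 2) → Fin 2 → 𝕜} (hh : ∀ t, block (h 1) t 0 = block (h 1) t 1)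
    (hgood : m * #{t | ¬ GoodChannel K (block (h 0) t 0) (block (h 0) t 1) (block (h 1) t 0)} ≤ n)
    {k : Fin 2} {y : Fin (n * 2) → 𝕜} {w w' : Fin (M ^ streamCount k)}
    (hw : Consistent ψ m r k h y w) (hw' : Consistent ψ m r k h y w') : w = w' := by
  refine finFunctionFinEquiv.symm.injective (funext fun j => hψ _ _ ?_)
  unfold Consistent at hw hw'
  set A : Finset (Fin n) := {t | ∃ i, 2 * r < ‖project k i (block y t - ownSignal ψ k h w t)‖}
  set A' : Finset (Fin n) := {t | ∃ i, 2 * r < ‖project k i (block y t - ownSignal ψ k h w' t)‖}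
  set G : Finset (Fin n) :=
    {t | ¬ GoodChannel K (block (h 0) t 0) (block (h 0) t 1) (block (h 1) t 0)}
  have hsub : ({t | s ≤ ‖ψ (finFunctionFinEquiv.symm w j) t -
      ψ (finFunctionFinEquiv.symm w' j) t‖} : Finset (Fin n)) ⊆ A ∪ A' ∪ G := by
    intro t ht
    by_contra hnot
    simp only [A, A', G, mem_union, mem_filter, mem_univ, true_and, not_or, not_exists, not_lt,
      not_not] at hnot ht
    obtain ⟨⟨h1, h2⟩, h3⟩ := hnot
    have h4 (i) : ‖project k i (blockSignal k (block (h 0) t 0) (block (h k) t)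
        (streamSymbols ψ k w t - streamSymbols ψ k w' t))‖ ≤ 4 * r := by
      have : blockSignal k (block (h 0) t 0) (block (h k) t)
          (streamSymbols ψ k w t - streamSymbols ψ k w' t) =
          (block y t - ownSignal ψ k h w' t) - (block y t - ownSignal ψ k h w t) := by
        rw [sub_sub_sub_cancel_left]
        ext τ
        exact (blockSignal_sub _ _ _ _ _ _).symm
      rw [this, project_sub]
      exact (norm_sub_le _ _).trans (by linarith [h1 i, h2 i])
    have h5 : ‖(streamSymbols ψ k w t - streamSymbols ψ k w' t) j‖ ≤ 4 * r * K := by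
      obtain rfl | rfl : k = 0 ∨ k = 1 := by omega
      · refine norm_stream_zero_le h3 (fun i => ?_) j
        have e : block (h 0) t = ![block (h 0) t 0, block (h 0) t 1] := by
          ext τ; fin_cases τ <;> rfl
        rw [← e]
        exact h4 i
      · refine norm_stream_one_le h3 (fun i => ?_) j
        have e : block (h 1) t = ![block (h 1) t 0, block (h 1) t 0] := by
          ext τ; fin_cases τ
          · rfl
          · exact congrFun (hh t).symm _
        rw [← e]
        exact h4 i
    exact absurd (ht.trans h5) (not_le.2 hs)
  calc _ ≤ m * (#A + #A' + #G) := Nat.mul_le_mul_left m ((card_le_card hsub).trans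
        ((card_union_le _ _).trans (Nat.add_le_add_right (card_union_le _ _) _)))
    _ ≤ 3 * n := by rw [mul_add, mul_add]; omega

variable [MeasurableSpace 𝕜] [BorelSpace 𝕜]

theorem measurableSet_consistent (ψ : Fin M → Fin n → 𝕜) (m : ℕ) (r : ℝ) (k : Fin 2)
    (w : Fin (M ^ streamCount k)) :
    MeasurableSet {x : (Fin 2 → Fin (n * 2) → Fin 2 → 𝕜) × (Fin (n * 2) → 𝕜) |
      Consistent ψ m r k x.1 x.2 w} := by
  have hown (t) : Measurable fun x : (Fin 2 → Fin (n * 2) → Fin 2 → 𝕜) × (Fin (n * 2) → 𝕜) =>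
      ownSignal ψ k x.1 w t := by
    refine measurable_pi_iff.2 fun τ => measurable_blockSignal k ?_ ?_ _ τ
    · exact measurable_pi_iff.1
        ((measurable_block t).comp ((measurable_pi_apply 0).comp measurable_fst)) 0
    · exact (measurable_block t).comp ((measurable_pi_apply k).comp measurable_fst)
  have hset (t) : MeasurableSet {x : (Fin 2 → Fin (n * 2) → Fin 2 → 𝕜) × (Fin (n * 2) → 𝕜) |
      ∃ i, 2 * r < ‖project k i (block x.2 t - ownSignal ψ k x.1 w t)‖} := by
    rw [Set.ofPred_exists]
    refine MeasurableSet.iUnion fun i => measurableSet_lt measurable_const ?_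
    exact ((measurable_project k i).comp
      (((measurable_block t).comp measurable_snd).sub (hown t))).norm
  have hcard : Measurable fun x : (Fin 2 → Fin (n * 2) → Fin 2 → 𝕜) × (Fin (n * 2) → 𝕜) =>
      Finset.card {t | ∃ i, 2 * r < ‖project k i (block x.2 t - ownSignal ψ k x.1 w t)‖} := by
    simp only [Finset.card_filter]
    exact Finset.measurable_sum _ fun t _ =>
      Measurable.ite (hset t) measurable_const measurable_const
  exact measurableSet_le (hcard.const_mul m) measurable_const

/-- The code of the scheme, with the codebook `ψ` for every stream. Each user looks for a message
consistent with what it receives. -/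
noncomputable def schemeCode (hM : 0 < M) (ψ : Fin M → Fin n → 𝕜) (m : ℕ) (r : ℝ) :
    Code 𝕜 (n * 2) where
  M k := M ^ streamCount k
  enc w h s a := ∑ k, ∑ j,
    beamVector k j (block h (finProdFinEquiv.symm s).1 0) (finProdFinEquiv.symm s).2 a *
      streamSymbols ψ k (w k) (finProdFinEquiv.symm s).1 j
  measurable_enc w := by
    refine measurable_pi_iff.2 fun s => measurable_pi_iff.2 fun a =>
      Finset.measurable_sum _ fun k _ => Finset.measurable_sum _ fun j _ => ?_
    exact ((measurable_beamVector k j _ a).comp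
      (measurable_pi_iff.1 (measurable_block _) 0)).mul_const _
  causal w h h' s hs := by
    have : block h (finProdFinEquiv.symm s).1 0 = block h' (finProdFinEquiv.symm s).1 0 := by
      refine hs _ ?_
      obtain ⟨⟨t, τ⟩, rfl⟩ := finProdFinEquiv.surjective s
      simp [Fin.le_def]
    simp only [this]
  dec k h y := chooseMessage (pow_pos hM _) (Consistent ψ m r k h y)
  measurable_dec k := by
    have h : Measurable fun x : (Fin 2 → Fin (n * 2) → Fin 2 → 𝕜) × (Fin (n * 2) → 𝕜) =>
        Consistent ψ m r k x.1 x.2 :=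
      measurable_pi_iff.2 fun w => measurable_to_prop (by
        simpa [Set.preimage] using measurableSet_consistent ψ m r k w)
    exact (measurable_of_finite (chooseMessage (pow_pos hM _))).comp h

theorem isLinearBeamforming_schemeCode (hM : 0 < M) (ψ : Fin M → Fin n → 𝕜) (m : ℕ) (r : ℝ) :
    (schemeCode hM ψ m r).IsLinearBeamforming (beamformer 𝕜) := by
  refine ⟨fun _ _ => M, fun k => finFunctionFinEquiv.symm, fun _ _ => ψ, fun w h t τ a => ?_⟩
  simp only [schemeCode, Equiv.symm_apply_apply]
  rfl

theorem powerAtMost_schemeCode (hM : 0 < M) {ψ : Fin M → Fin n → 𝕜} (m : ℕ) (r : ℝ) {P : ℝ}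
    (hP : 0 ≤ P) (hψ : ∀ w t, ‖ψ w t‖ ≤ √P / 3) : (schemeCode hM ψ m r).PowerAtMost P := by
  intro w h
  have hP' : 0 ≤ √P / 3 := by positivity
  have hle : ∀ s a, ‖(schemeCode hM ψ m r).enc w h s a‖ ^ 2 ≤ P / 2 := by
    intro s a
    have h0 : ‖∑ j, beamVector 0 j (block h (finProdFinEquiv.symm s).1 0)
        (finProdFinEquiv.symm s).2 a * streamSymbols ψ 0 (w 0) (finProdFinEquiv.symm s).1 j‖ ≤
        √P / 3 := by
      change ‖∑ j : Fin 2, (if (a : ℕ) = j then (1 : 𝕜) else 0) *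
        streamSymbols ψ 0 (w 0) (finProdFinEquiv.symm s).1 j‖ ≤ √P / 3
      fin_cases a <;> simpa [Fin.sum_univ_two, streamSymbols] using hψ _ _
    have h1 : ‖∑ j, beamVector 1 j (block h (finProdFinEquiv.symm s).1 0)
        (finProdFinEquiv.symm s).2 a * streamSymbols ψ 1 (w 1) (finProdFinEquiv.symm s).1 j‖ ≤
        √P / 3 := by
      change ‖∑ j : Fin 1, (if (finProdFinEquiv.symm s).2 = 0 then zeroForcing _ a else 0) *
        streamSymbols ψ 1 (w 1) (finProdFinEquiv.symm s).1 j‖ ≤ √P / 3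
      rw [Fin.sum_univ_one, norm_mul]
      refine (mul_le_of_le_one_left (norm_nonneg _) ?_).trans (hψ _ _)
      split_ifs
      · exact norm_zeroForcing_le _ _
      · simp
    have h2 : ‖(schemeCode hM ψ m r).enc w h s a‖ ≤ √P / 3 + √P / 3 := by
      simp only [schemeCode, Fin.sum_univ_two]
      exact (norm_add_le _ _).trans (add_le_add h0 h1)
    calc _ ≤ (√P / 3 + √P / 3) ^ 2 := by gcongr
      _ = 4 / 9 * √P ^ 2 := by ring
      _ = 4 / 9 * P := by rw [Real.sq_sqrt hP]
      _ ≤ _ := by linarith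
  calc _ ≤ ∑ _s : Fin (n * 2), ∑ _a : Fin 2, P / 2 :=
        Finset.sum_le_sum fun s _ => Finset.sum_le_sum fun a _ => hle s a
    _ = _ := by
      simp only [Finset.sum_const, Finset.card_univ, Fintype.card_fin, nsmul_eq_mul]
      push_cast
      ring

/-! ### Error analysis -/

theorem block_received (hM : 0 < M) (ψ : Fin M → Fin n → 𝕜) (m : ℕ) (r : ℝ)
    (h : Fin 2 → Fin (n * 2) → Fin 2 → 𝕜) (w : ∀ k, Fin (M ^ streamCount k))
    (z : Fin 2 → Fin (n * 2) → 𝕜) (k : Fin 2) (t : Fin n) :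
    block ((schemeCode hM ψ m r).received h w z k) t =
      ∑ k', blockSignal k' (block (h 0) t 0) (block (h k) t) (streamSymbols ψ k' (w k') t) +
        block (z k) t := by
  ext τ
  simp only [block, Code.received, schemeCode, Equiv.symm_apply_apply, Pi.add_apply,
    Finset.sum_apply, blockSignal]
  simp only [Finset.mul_sum, add_left_inj]
  rw [Finset.sum_comm]

theorem project_received_sub (hM : 0 < M) (ψ : Fin M → Fin n → 𝕜) (m : ℕ) (r : ℝ)
    {h : Fin 2 → Fin (n * 2) → Fin 2 → 𝕜} (hh : ∀ t, block (h 1) t 0 = block (h 1) t 1)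
    (w : ∀ k, Fin (M ^ streamCount k)) (z : Fin 2 → Fin (n * 2) → 𝕜) (k i : Fin 2) (t : Fin n) :
    project k i (block ((schemeCode hM ψ m r).received h w z k) t - ownSignal ψ k h (w k) t) =
      project k i (block (z k) t) := by
  rw [block_received, Fin.sum_univ_two, project_sub, project_add, project_add]
  fin_cases k
  · simp [ownSignal, project_zero_blockSignal_one]
  · simp [ownSignal, project_one_blockSignal_zero _ (hh t)]

open Finset in
theorem consistent_of_typicalNoise (hM : 0 < M) (ψ : Fin M → Fin n → 𝕜) {m : ℕ} {r : ℝ}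
    (hr : 0 ≤ r) {h : Fin 2 → Fin (n * 2) → Fin 2 → 𝕜}
    (hh : ∀ t, block (h 1) t 0 = block (h 1) t 1) (w : ∀ k, Fin (M ^ streamCount k))
    {z : Fin 2 → Fin (n * 2) → 𝕜} (hz : z ∈ typicalNoise 𝕜 n m r) (k : Fin 2) :
    Consistent ψ m r k h ((schemeCode hM ψ m r).received h w z k) (w k) := by
  refine le_trans (Nat.mul_le_mul_left m ?_) (hz k)
  refine le_trans (card_le_card fun t ht => ?_)
    (card_image_le (f := fun s => (finProdFinEquiv.symm s).1))
  simp only [mem_filter, mem_univ, true_and, project_received_sub hM ψ m r hh] at ht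
  obtain ⟨i, hi⟩ := ht
  have : ∃ τ, r < ‖block (z k) t τ‖ := by
    by_contra! hle
    exact absurd hi (not_lt.2 (norm_project_le k i hr hle))
  obtain ⟨τ, hτ⟩ := this
  exact mem_image.2 ⟨finProdFinEquiv (t, τ), by simpa [block] using hτ, by simp⟩

open Finset in
open scoped Classical in
theorem errorProb_schemeCode_le (hM : 0 < M) {ψ : Fin M → Fin n → 𝕜} {m : ℕ} {r s K : ℝ}
    (hr : 0 ≤ r) (hnoise : noise 𝕜 {z | r < ‖z‖} ≤ (16⁻¹ : ENNReal) ^ m) (hs : 4 * r * K < s)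
    (hψ : ∀ w w', m * #{t | s ≤ ‖ψ w t - ψ w' t‖} ≤ 3 * n → w = w')
    {h : Fin 2 → Fin (n * 2) → Fin 2 → 𝕜} (hh : ∀ t, block (h 1) t 0 = block (h 1) t 1)
    (hgood : m * #{t | ¬ GoodChannel K (block (h 0) t 0) (block (h 0) t 1) (block (h 1) t 0)} ≤
      n) : (schemeCode hM ψ m r).errorProb h ≤ 2 * (1 / 4) ^ n := by
  have hcard : 0 < Fintype.card (∀ k, Fin ((schemeCode hM ψ m r).M k)) := by
    exact Fintype.card_pos_iff.2 ⟨fun k => ⟨0, pow_pos hM _⟩⟩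
  rw [Code.errorProb, div_le_iff₀ (by exact_mod_cast hcard)]
  have hw (w : ∀ k, Fin ((schemeCode hM ψ m r).M k)) :
      (Measure.pi fun _ : Fin 2 => Measure.pi fun _ : Fin (n * 2) => noise 𝕜).real
        {z | ∃ k, (schemeCode hM ψ m r).dec k h ((schemeCode hM ψ m r).received h w z k) ≠ w k} ≤
          2 * (1 / 4) ^ n := by
    have hsub : {z | ∃ k, (schemeCode hM ψ m r).dec k h
        ((schemeCode hM ψ m r).received h w z k) ≠ w k} ⊆ (typicalNoise 𝕜 n m r)ᶜ := by
      rintro z ⟨k, hk⟩ hz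
      have hc := consistent_of_typicalNoise hM ψ hr hh w hz k
      exact hk (chooseMessage_eq _ hc fun w' hw' => eq_of_consistent hs hψ hh hgood hw' hc)
    have h1 := ENNReal.toReal_mono (by simp [ENNReal.mul_eq_top, ENNReal.pow_eq_top_iff])
      ((measure_mono hsub).trans (measure_compl_typicalNoise_le hnoise))
    refine h1.trans (le_of_eq ?_)
    simp
  calc _ ≤ ∑ _w : (∀ k, Fin ((schemeCode hM ψ m r).M k)), (2 * (1 / 4) ^ n : ℝ) :=
        Finset.sum_le_sum fun w _ => hw w
    _ = _ := by rw [Finset.sum_const, nsmul_eq_mul, Finset.card_univ, mul_comm]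

end
/-! ### Fading -/

theorem block_channel {𝕜 : Type*} (g : BlockStates 𝕜) {n : ℕ} (k : Fin 2) (t : Fin n) (τ : Fin 2) :
    block (channel g (n * 2) k) t τ = g (if k = 0 then t + τ else t) k := by
  simp only [block, channel, blockIndex, finProdFinEquiv_apply_val]
  have := τ.isLt
  congr 1
  split_ifs <;> omega

section
variable {𝕜 : Type*} [RCLike 𝕜]

/-- The fading realizations for which the channel is bad in the supersymbol `0`. -/
def badStates (𝕜 : Type*) [RCLike 𝕜] (K : ℝ) : Set (BlockStates 𝕜) :=
  {x | ¬ GoodChannel K (x 0 0) (x 1 0) (x 0 1)}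

theorem goodChannel_mono {K K' : ℝ} (h : K ≤ K') {v v' f : Fin 2 → 𝕜} (hg : GoodChannel K v v' f) :
    GoodChannel K' v v' f :=
  ⟨hg.1.trans (by gcongr), hg.2.trans (by gcongr)⟩

theorem exists_goodChannel {v v' f : Fin 2 → 𝕜} (h1 : det₂ v v' ≠ 0) (h2 : det₂ v f ≠ 0) :
    ∃ K : ℕ, GoodChannel K v v' f := by
  obtain ⟨K₁, h⟩ := exists_nat_ge ((1 + ‖v 0‖ + ‖v 1‖ + ‖v' 0‖ + ‖v' 1‖) / ‖det₂ v v'‖)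
  obtain ⟨K₂, h'⟩ := exists_nat_ge ((1 + ‖v 0‖ + ‖v 1‖ + ‖v' 0‖ + ‖v' 1‖) / ‖det₂ v f‖)
  rw [div_le_iff₀ (norm_pos_iff.2 h1)] at h
  rw [div_le_iff₀ (norm_pos_iff.2 h2)] at h'
  refine ⟨K₁ + K₂, ?_, ?_⟩ <;> push_cast <;>
    nlinarith [norm_nonneg (det₂ v v'), norm_nonneg (det₂ v f), (Nat.cast_nonneg K₁ : (0 : ℝ) ≤ K₁),
      (Nat.cast_nonneg K₂ : (0 : ℝ) ≤ K₂)]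

variable [MeasurableSpace 𝕜] [BorelSpace 𝕜]

theorem measurableSet_badStates (K : ℝ) : MeasurableSet (badStates 𝕜 K) :=
  (measurableSet_goodChannel K (v := fun x : BlockStates 𝕜 => x 0 0) (v' := fun x => x 1 0)
    (f := fun x => x 0 1) (by fun_prop) (by fun_prop) (by fun_prop)).compl

variable {Ω : Type*} [MeasurableSpace Ω] {μ : Measure Ω} {g : Ω → BlockStates 𝕜}

theorem IsGenericFading.ae_det₂_ne_zero (hg : IsGenericFading μ g) :
    ∀ᵐ x ∂(μ.map g), det₂ (x 0 0) (x 1 0) ≠ 0 ∧ det₂ (x 0 0) (x 0 1) ≠ 0 := by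
  have hm : Measurable fun ω => (![g ω 0 0, g ω (0 + 1) 0, g ω 0 1] : Fin 3 → Fin 2 → 𝕜) := by
    have h (b k) : Measurable fun ω => g ω b k :=
      measurable_pi_iff.1 (measurable_pi_iff.1 hg.measurable b) k
    refine measurable_pi_iff.2 fun i => ?_
    fin_cases i
    exacts [h 0 0, h 1 0, h 0 1]
  have h1 (i j : Fin 3) (hij : i ≠ j) := ae_of_ae_map hm.aemeasurable
    ((hg.generic 0).ae_le (ae_iff.2 (by simpa using addHaar_det₂_eq_zero hij) :
      ∀ᵐ x ∂(Measure.addHaar : Measure (Fin 3 → Fin 2 → 𝕜)), det₂ (x i) (x j) ≠ 0))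
  have hd (b c : ℕ) (k l : Fin 2) : MeasurableSet {x : BlockStates 𝕜 | det₂ (x b k) (x c l) ≠ 0} :=
    ((measurable_det₂ (by fun_prop) (by fun_prop)) (measurableSet_singleton 0)).compl
  refine (ae_map_iff hg.measurable.aemeasurable ((hd 0 1 0 0).inter (hd 0 0 0 1))).2 ?_
  filter_upwards [h1 0 1 (by decide), h1 0 2 (by decide)] with ω h h'
  exact ⟨h, h'⟩

variable [IsProbabilityMeasure μ]

theorem IsGenericFading.tendsto_measure_badStates (hg : IsGenericFading μ g) :
    Tendsto (fun K : ℕ => μ.map g (badStates 𝕜 K)) atTop (𝓝 0) := by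
  have := Measure.isProbabilityMeasure_map (μ := μ) hg.measurable.aemeasurable
  have ht := tendsto_measure_iInter_atTop (μ := μ.map g) (s := fun K : ℕ => badStates 𝕜 K)
    (fun K => (measurableSet_badStates _).nullMeasurableSet)
    (fun i j hij x hx h => hx (goodChannel_mono (by exact_mod_cast hij) h)) ⟨0, measure_ne_top _ _⟩
  have h0 : μ.map g (⋂ K : ℕ, badStates 𝕜 K) = 0 := by
    refine measure_mono_null (t := {x | ¬ (det₂ (x 0 0) (x 1 0) ≠ 0 ∧ det₂ (x 0 0) (x 0 1) ≠ 0)})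
      (fun x hx h => ?_) hg.ae_det₂_ne_zero
    obtain ⟨K, hK⟩ := exists_goodChannel h.1 h.2
    exact Set.mem_iInter.1 hx K hK
  rwa [h0] at ht

open Finset in
open scoped Classical in
/-- There are invertibility thresholds such that, for almost every realization and all large `j`,
the fraction of bad supersymbols never exceeds `1 / (j + 3)`. The process need not be ergodic: the
maximal ergodic inequality and the Borel–Cantelli lemma suffice. -/
theorem IsGenericFading.exists_threshold (hg : IsGenericFading μ g) :
    ∃ K : ℕ → ℕ, ∀ᵐ ω ∂μ, ∀ᶠ j in atTop, ∀ n,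
      (j + 3) * #{t : Fin n | ¬ GoodChannel (K j) (g ω t 0) (g ω (t + 1) 0) (g ω t 1)} ≤ n := by
  have := Measure.isProbabilityMeasure_map (μ := μ) hg.measurable.aemeasurable
  set T : BlockStates 𝕜 → BlockStates 𝕜 := fun x b => x (b + 1)
  have hTm : Measurable T := measurable_pi_iff.2 fun b => measurable_pi_apply _
  have hT : MeasurePreserving T (μ.map g) (μ.map g) :=
    ⟨hTm, by rw [Measure.map_map hTm hg.measurable]; exact hg.stationary⟩
  have hiter (t : ℕ) (x : BlockStates 𝕜) (b : ℕ) : T^[t] x b = x (t + b) := by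
    induction t generalizing x with
    | zero => simp
    | succ t ih => rw [Function.iterate_succ_apply, ih]; simp only [T]; congr 1; omega
  have hK (j : ℕ) : ∃ K : ℕ, ((j + 3 : ℕ) : ENNReal) * μ.map g (badStates 𝕜 K) < 2⁻¹ ^ j := by
    have h := ENNReal.Tendsto.const_mul (a := ((j + 3 : ℕ) : ENNReal)) hg.tendsto_measure_badStates
      (Or.inr (ENNReal.natCast_ne_top _))
    rw [mul_zero] at h
    exact (h.eventually_lt_const (ENNReal.pow_pos (by simp) j)).exists
  choose K hK using hK
  refine ⟨K, ae_of_ae_map hg.measurable.aemeasurable (p := fun x => ∀ᶠ j in atTop, ∀ n,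
      (j + 3) * #{t : Fin n | ¬ GoodChannel (K j) (x t 0) (x (t + 1) 0) (x t 1)} ≤ n) ?_⟩
  have hsum : ∑' j, μ.map g {x | ∃ n, n < (j + 3) * #{t ∈ range n | T^[t] x ∈ badStates 𝕜 (K j)}} ≠
      ⊤ := by
    refine ne_top_of_le_ne_top ?_ (ENNReal.tsum_le_tsum fun j =>
      (measure_exists_visits_le hT (measurableSet_badStates _) (by omega)).trans (hK j).le)
    simp [ENNReal.tsum_geometric]
  filter_upwards [ae_eventually_notMem hsum] with x hx
  filter_upwards [hx] with j hj n
  simp only [not_exists, not_lt] at hj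
  refine le_of_eq_of_le ?_ (hj n)
  congr 1
  simp only [card_filter]
  rw [Finset.sum_range]
  simp [badStates, hiter]

end

/-! ### The rate -/

/-- Every sequence of requirements is met along some index that grows with `P`. -/
theorem exists_slow_index (A : ℕ → ℝ) :
    ∃ J : ℝ → ℕ, Tendsto J atTop atTop ∧ ∀ᶠ P in atTop, A (J P) ≤ P := by
  classical
  refine ⟨fun P => Nat.findGreatest (fun j => A j ≤ P) ⌊P⌋₊, tendsto_atTop.2 fun b => ?_, ?_⟩
  · filter_upwards [eventually_ge_atTop (A b), eventually_ge_atTop (b : ℝ)] with P h h'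
    exact Nat.le_findGreatest (Nat.le_floor h') h
  · filter_upwards [eventually_ge_atTop (A 0)] with P h
    exact Nat.findGreatest_spec (P := fun j => A j ≤ P) (Nat.zero_le _) h

/-- The rate of one stream per supersymbol, relative to the logarithm of the power, tends to one:
the loss of the outer code vanishes as `J P` grows, and the constellation spacing costs
at most `log P / (J P + 1)`. -/
theorem tendsto_streamRate {d : ℝ} (hd : 0 < d) {A : ℕ → ℝ} (hA : ∀ j, 1 ≤ A j) {J : ℝ → ℕ}
    (hJ : Tendsto J atTop atTop) (hAJ : ∀ᶠ P in atTop, A (J P) ^ (J P + 1) ≤ P) :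
    Tendsto (fun P => ((1 - 3 / ((J P + 3 : ℕ) : ℝ)) * (d * (Real.log P / 2 - Real.log (A (J P)))) -
      Real.log 2) / (d / 2 * Real.log P)) atTop (𝓝 1) := by
  have h1 : Tendsto (fun P => 1 / ((J P : ℝ) + 1)) atTop (𝓝 0) :=
    tendsto_one_div_add_atTop_nhds_zero_nat.comp hJ
  have h2 : Tendsto (fun P => 3 / ((J P + 3 : ℕ) : ℝ)) atTop (𝓝 0) :=
    (tendsto_const_div_atTop_nhds_zero_nat 3).comp ((tendsto_add_atTop_nat 3).comp hJ)
  have hlog0 : ∀ᶠ P in atTop, 0 < Real.log P := Real.tendsto_log_atTop.eventually_gt_atTop 0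
  have h3 : Tendsto (fun P => Real.log (A (J P)) / Real.log P) atTop (𝓝 0) := by
    refine tendsto_of_tendsto_of_tendsto_of_le_of_le' tendsto_const_nhds h1 ?_ ?_
    · filter_upwards [hlog0] with P hP
      exact div_nonneg (Real.log_nonneg (hA _)) hP.le
    · filter_upwards [hlog0, hAJ] with P hP h
      have hA0 : 0 < A (J P) := zero_lt_one.trans_le (hA _)
      have h' := Real.log_le_log (by positivity) h
      rw [Real.log_pow] at h'
      push_cast at h'
      rw [div_le_div_iff₀ hP (by positivity)]
      linarith
  have h4 : Tendsto (fun P => Real.log 2 * 2 / d / Real.log P) atTop (𝓝 0) :=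
    tendsto_const_nhds.div_atTop Real.tendsto_log_atTop
  have h5 := ((h2.const_sub 1).mul ((h3.const_mul 2).const_sub 1)).sub h4
  simp only [sub_zero, mul_zero, mul_one] at h5
  refine h5.congr' ?_
  filter_upwards [hlog0] with P hP
  have : ((J P + 3 : ℕ) : ℝ) ≠ 0 := by positivity
  field_simp

end StaggeredBC

open StaggeredBC in
theorem theorem1 {𝕜 : Type*} [RCLike 𝕜] [MeasurableSpace 𝕜] [BorelSpace 𝕜]
    {Ω : Type*} [MeasurableSpace Ω] (μ : Measure Ω) [IsProbabilityMeasure μ]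
    (g : Ω → StaggeredBC.BlockStates 𝕜) (hg : StaggeredBC.IsGenericFading μ g) :
    ∃ (L : Fin 2 → ℕ) (B : StaggeredBC.Beamformer 𝕜 L)
      (C : ℝ → (n : ℕ) → StaggeredBC.Code 𝕜 (n * 2)) (d : Fin 2 → ℝ),
      (∀ P n, (C P n).IsLinearBeamforming B) ∧
      (∀ k, 0 ≤ d k) ∧ d 0 + d 1 = 3 / 2 ∧
      StaggeredBC.AchievesDoF μ g C d := by
  classical
  obtain ⟨K, hK⟩ := hg.exists_threshold
  have hr (j : ℕ) := exists_noise_radius 𝕜 (ε := (16⁻¹ : ENNReal) ^ (j + 3))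
    (ENNReal.pow_pos (by simp) _)
  choose r hr0 hr using hr
  obtain ⟨c, hc, hψ⟩ := exists_codebook 𝕜
  -- The spacing exceeds the effect of noise of size `r j` at both ends after channel inversion.
  set s : ℕ → ℝ := fun j => 4 * r j * K j + 1
  have hs1 (j : ℕ) : 1 ≤ s j := by
    have := hr0 j
    exact le_add_of_nonneg_left (by positivity)
  -- The parameters depend on `P` through a slow index `J P`, so that `log (s (J P)) = o(log P)`.
  obtain ⟨J, hJ, hAJ⟩ := exists_slow_index fun j => (3 * c * s j) ^ (j + 1)
  choose M ψ hψP hψs hM hψR using fun (P : ℝ) (n : ℕ) =>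
    hψ (s (J P)) P (J P + 3) n (zero_lt_one.trans_le (hs1 _)) (by omega)
  have hd : (0 : ℝ) < Module.finrank ℝ 𝕜 := by exact_mod_cast Module.finrank_pos
  refine ⟨streamCount, beamformer 𝕜, fun P n => schemeCode (hM P n) (ψ P n) (J P + 3) (r (J P)),
    fun k => streamCount k / 2, fun P n => isLinearBeamforming_schemeCode _ _ _ _,
    fun k => by positivity, by norm_num [streamCount], fun P hP n =>
      powerAtMost_schemeCode _ _ _ hP.le (hψP P n),
    ⟨fun P k => ((1 - 3 / ((J P + 3 : ℕ) : ℝ)) * (Module.finrank ℝ 𝕜 *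
      (Real.log P / 2 - Real.log (3 * c * s (J P)))) - Real.log 2) * (streamCount k / 2),
      fun k => ?_, fun P hP n k => ?_⟩, ?_⟩
  · have h := (tendsto_streamRate hd (A := fun j => 3 * c * s j)
      (fun j => by nlinarith [hs1 j, hc]) hJ hAJ).mul_const ((streamCount k : ℝ) / 2)
    rw [one_mul] at h
    exact h.congr fun P => by ring
  · have h := pow_le_pow_left₀ (Real.exp_pos _).le (hψR P n hP) (streamCount k)
    rw [← Real.exp_nat_mul] at h
    refine le_trans (le_of_eq ?_) (h.trans (by simp [schemeCode]))
    congr 1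
    push_cast
    ring
  · filter_upwards [hK] with ω hω
    filter_upwards [hJ.eventually hω] with P hP
    refine squeeze_zero (g := fun n : ℕ => 2 * (1 / 4 : ℝ) ^ n)
      (fun n => div_nonneg (Finset.sum_nonneg fun _ _ => measureReal_nonneg) (by positivity))
      (fun n => errorProb_schemeCode_le (K := K (J P)) _ (hr0 _).le (hr _).le (lt_add_one _)
        (hψs P n) (fun t => by simp [block_channel]) ?_) ?_
    · refine le_of_eq_of_le ?_ (hP n)
      exact congrArg (fun S : Finset (Fin n) => (J P + 3) * S.card)
        (Finset.filter_congr fun t _ => by simp [block_channel])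
    · simpa using (tendsto_pow_atTop_nhds_zero_of_lt_one (by norm_num : (0 : ℝ) ≤ 1 / 4)
        (by norm_num)).const_mul 2
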